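/- Let formulas be built from variables $p_0,p_1,p_2,\dots$ with $\neg,\wedge,\vee$, the connexive implication $\rightarrow$, and the modalities $\Box,\Diamond$. Write $A\supset B$ for $\neg A\vee B$ and $A\equiv B$ for $(\neg A\vee B)\wedge(\neg B\vee A)$. Let $d(A)$ be the demodalization of $A$, that is, the result of deleting all occurrences of $\Box$ and $\Diamond$ in $A$: $d(p)=p$ for variables $p$, $d(\neg A)=\neg d(A)$, $d(A\star B)=d(A)\star d(B)$ for $\star\in\{\wedge,\vee,\rightarrow\}$, and $d(\Box A)=d(\Diamond A)=d(A)$. Let $Ax_{\mathsf{MBCL}}^{\mathsf{CUDL}}$ be the Hilbert-style calculus whose axioms are, for all formulas $A,B$: all substitution instances of classical propositional tautologies in the connectives $\neg,\wedge,\vee$; $$\neg(A\rightarrow\neg A);\qquad \neg(\neg A\rightarrow A);$$ $$(A\rightarrow B)\rightarrow\neg(A\rightarrow\neg B);\qquad (A\rightarrow\neg B)\rightarrow\neg(A\rightarrow B);$$ $$(A\rightarrow B)\supset(A\supset B);\qquad \Diamond A\equiv\neg\Box\neg A;\qquad \Box(A\supset B)\supset(\Box A\supset\Box B);$$ $$(\mathsf{CUDL})\qquad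 (d(A)\rightarrow d(B))\supset\bigl((A\rightarrow B)\vee(A\wedge\neg B)\bigr);$$ and whose rules are: from $A$ and $A\supset B$ infer $B$; from $\vdash A$ infer $\vdash\Box A$. Then the logic $Ax_{\mathsf{MBCL}}^{\mathsf{CUDL}}$ is decidable: there is an algorithm which, given a formula $A$, decides whether $A$ is derivable in $Ax_{\mathsf{MBCL}}^{\mathsf{CUDL}}$. -/

import Mathlib

namespace MBCL

/-- Formulas of the language of modal Boolean connexive logic, over the variables
`p₀, p₁, p₂, …`; `arrow` is the connexive (relating) implication. -/
inductive Formula : Type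
  | var : ℕ → Formula
  | neg : Formula → Formula
  | and : Formula → Formula → Formula
  | or : Formula → Formula → Formula
  | arrow : Formula → Formula → Formula
  | box : Formula → Formula
  | dia : Formula → Formula
  deriving DecidableEq

namespace Formula

/-- Material implication `A ⊃ B`, an abbreviation of `¬A ∨ B`. -/
def imp (A B : Formula) : Formula := or (neg A) B

/-- Material equivalence `A ≡ B`, an abbreviation of `(¬A ∨ B) ∧ (¬B ∨ A)`. -/
def equ (A B : Formula) : Formula := and (or (neg A) B) (or (neg B) A)

/-- Demodalization: all occurrences of `□` and `◇` are removed. -/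
def demod : Formula → Formula
  | var n => var n
  | neg A => neg (demod A)
  | and A B => and (demod A) (demod B)
  | or A B => or (demod A) (demod B)
  | arrow A B => arrow (demod A) (demod B)
  | box A => demod A
  | dia A => demod A

/-- An explicit Gödel numbering of formulas. -/
def toNat : Formula → ℕ
  | var n => 7 * n
  | neg A => 7 * toNat A + 1
  | and A B => 7 * Nat.pair (toNat A) (toNat B) + 2
  | or A B => 7 * Nat.pair (toNat A) (toNat B) + 3
  | arrow A B => 7 * Nat.pair (toNat A) (toNat B) + 4
  | box A => 7 * toNat A + 5
  | dia A => 7 * toNat A + 6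

/-- The formula with a given Gödel number. -/
def ofNat (n : ℕ) : Formula :=
  if h : n % 7 = 0 then var (n / 7)
  else
    have hn : n / 7 < n := Nat.div_lt_self (by omega) (by norm_num)
    have h₁ : (n / 7).unpair.1 < n := (Nat.unpair_left_le _).trans_lt hn
    have h₂ : (n / 7).unpair.2 < n := (Nat.unpair_right_le _).trans_lt hn
    if n % 7 = 1 then neg (ofNat (n / 7))
    else if n % 7 = 2 then and (ofNat (n / 7).unpair.1) (ofNat (n / 7).unpair.2)
    else if n % 7 = 3 then or (ofNat (n / 7).unpair.1) (ofNat (n / 7).unpair.2)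
    else if n % 7 = 4 then arrow (ofNat (n / 7).unpair.1) (ofNat (n / 7).unpair.2)
    else if n % 7 = 5 then box (ofNat (n / 7))
    else dia (ofNat (n / 7))
termination_by n

theorem ofNat_toNat (A : Formula) : ofNat (toNat A) = A := by
  induction A with
  | var n => rw [toNat, ofNat]; simp
  | neg A ih => rw [toNat, ofNat]; simp [Nat.mul_add_mod, Nat.mul_add_div, ih]
  | and A B ihA ihB => rw [toNat, ofNat]; simp [Nat.mul_add_mod, Nat.mul_add_div, ihA, ihB]
  | or A B ihA ihB => rw [toNat, ofNat]; simp [Nat.mul_add_mod, Nat.mul_add_div, ihA, ihB]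
  | arrow A B ihA ihB => rw [toNat, ofNat]; simp [Nat.mul_add_mod, Nat.mul_add_div, ihA, ihB]
  | box A ih => rw [toNat, ofNat]; simp [Nat.mul_add_mod, Nat.mul_add_div, ih]
  | dia A ih => rw [toNat, ofNat]; simp [Nat.mul_add_mod, Nat.mul_add_div, ih]

theorem toNat_ofNat (n : ℕ) : toNat (ofNat n) = n := by
  induction n using Nat.strong_induction_on with
  | _ n ih =>
    by_cases h : n % 7 = 0
    · rw [ofNat, dif_pos h, toNat]; omega
    · have hn : n / 7 < n := Nat.div_lt_self (by omega) (by norm_num)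
      have e := ih _ hn
      have e₁ := ih _ ((Nat.unpair_left_le (n / 7)).trans_lt hn)
      have e₂ := ih _ ((Nat.unpair_right_le (n / 7)).trans_lt hn)
      rw [ofNat, dif_neg h]
      dsimp only
      split_ifs <;> simp only [toNat, e, e₁, e₂, Nat.pair_unpair] <;> omega

/-- The Gödel numbering as a bijection between formulas and natural numbers. -/
def equivNat : Formula ≃ ℕ where
  toFun := toNat
  invFun := ofNat
  left_inv := ofNat_toNat
  right_inv := toNat_ofNat

/-- Computability over formulas is computability over their Gödel numbers. -/
instance : Primcodable Formula := Primcodable.ofEquiv ℕ equivNat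

end Formula

/-- Formulas of classical propositional logic, in the connectives `¬`, `∧`, `∨`. -/
inductive PropFormula : Type
  | var : ℕ → PropFormula
  | neg : PropFormula → PropFormula
  | and : PropFormula → PropFormula → PropFormula
  | or : PropFormula → PropFormula → PropFormula

namespace PropFormula

/-- The truth value of a classical formula under a valuation of the variables. -/
def eval (v : ℕ → Bool) : PropFormula → Bool
  | var n => v n
  | neg φ => !(eval v φ)
  | and φ ψ => eval v φ && eval v ψ
  | or φ ψ => eval v φ || eval v ψ

/-- Classical tautologies. -/
def IsTautology (φ : PropFormula) : Prop := ∀ v : ℕ → Bool, eval v φ = true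

/-- Uniform substitution of formulas of the modal connexive language for the variables. -/
def subst (σ : ℕ → Formula) : PropFormula → Formula
  | var n => σ n
  | neg φ => Formula.neg (subst σ φ)
  | and φ ψ => Formula.and (subst σ φ) (subst σ ψ)
  | or φ ψ => Formula.or (subst σ φ) (subst σ ψ)

end PropFormula

open Formula in
/-- Derivability of a formula (from no premises) in the Hilbert-style calculus for modal Boolean
connexive logic extended by the schema `CUDL` of closure under demodalization. -/
inductive Derivable : Formula → Prop
  /-- Substitution instances of classical tautologies. -/
  | cpl (φ : PropFormula) (hφ : φ.IsTautology) (σ : ℕ → Formula) : Derivable (φ.subst σ)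
  /-- First law of Aristotle: `¬(A → ¬A)`. -/
  | a1 (A : Formula) : Derivable (neg (arrow A (neg A)))
  /-- Second law of Aristotle: `¬(¬A → A)`. -/
  | a2 (A : Formula) : Derivable (neg (arrow (neg A) A))
  /-- First law of Boethius: `(A → B) → ¬(A → ¬B)`. -/
  | b1 (A B : Formula) : Derivable (arrow (arrow A B) (neg (arrow A (neg B))))
  /-- Second law of Boethius: `(A → ¬B) → ¬(A → B)`. -/
  | b2 (A B : Formula) : Derivable (arrow (arrow A (neg B)) (neg (arrow A B)))
  /-- `(A → B) ⊃ (A ⊃ B)`. -/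
  | impl (A B : Formula) : Derivable (imp (arrow A B) (imp A B))
  /-- `◇A ≡ ¬□¬A`. -/
  | dual (A : Formula) : Derivable (equ (dia A) (neg (box (neg A))))
  /-- `□(A ⊃ B) ⊃ (□A ⊃ □B)`. -/
  | k (A B : Formula) : Derivable (imp (box (imp A B)) (imp (box A) (box B)))
  /-- `CUDL`: `(d(A) → d(B)) ⊃ ((A → B) ∨ (A ∧ ¬B))`. -/
  | cudl (A B : Formula) :
      Derivable (imp (arrow (demod A) (demod B)) (or (arrow A B) (and A (neg B))))
  /-- From `A` and `A ⊃ B` infer `B`. -/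
  | ds (A B : Formula) (hA : Derivable A) (hAB : Derivable (imp A B)) : Derivable B
  /-- Necessitation: from `⊢ A` infer `⊢ □A`. -/
  | nec (A : Formula) (hA : Derivable A) : Derivable (box A)

end MBCL

/-! The logic has the finite model property with a computable bound on the countermodel, so
derivability reduces to a bounded search, which is even primitive recursive. Fix a formula `A` and
let `N = toNat A + 1`. The formulas with Gödel number below `N` form a finite fragment closed under
subformulas, under demodalization, and under passing from `C → ¬D` to `C → D`. A world is a subset
of the fragment, coded by some `t < 2 ^ N`; a model is a set of worlds, coded by some `M < 2 ^ 2 ^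
N`. `IsModel` lists conditions on `M` that involve only the fragment and are therefore checkable.

Completeness (`isModel_canonical`): the traces on the fragment of all maximal consistent theories
form a model, so an underivable `A` fails at one of its worlds.

Soundness (`IsModel.sound`) is the delicate half, since the axioms also speak of implications
outside the fragment, about which worlds record nothing. `Eval` declares such an implication true
when the material implication holds and the demodalized sides are `Related`: they form an instance
of a law of Boethius, or the world contains their implication. This makes CUDL and the laws of
Boethius hold; the remaining danger, `C → D` and `C → ¬D` both true, is excluded by
`IsModel.not_eval_arrow_neg`. -/

namespace MBCL

/-! ### Boolean valuations, maximal consistent theories and the Lindenbaum lemma -/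

open Formula

/-- A two-valued assignment to all formulas that respects `¬`, `∧` and `∨`. -/
structure IsVal (v : Formula → Bool) : Prop where
  neg : ∀ A, v (neg A) = !v A
  and : ∀ A B, v (and A B) = (v A && v B)
  or : ∀ A B, v (or A B) = (v A || v B)

theorem IsVal.imp {v : Formula → Bool} (hv : IsVal v) (A B : Formula) :
    v (imp A B) = (!v A || v B) := by
  rw [Formula.imp, hv.or, hv.neg]

theorem IsVal.equ {v : Formula → Bool} (hv : IsVal v) (A B : Formula) :
    v (equ A B) = (v A == v B) := by
  rw [Formula.equ, hv.and, hv.or, hv.or, hv.neg, hv.neg]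
  cases v A <;> cases v B <;> rfl

/-- The propositional skeleton of a formula: variables, implications and modal formulas become
propositional variables, indexed by their Gödel numbers. -/
def Formula.skeleton : Formula → PropFormula
  | neg A => .neg (skeleton A)
  | and A B => .and (skeleton A) (skeleton B)
  | or A B => .or (skeleton A) (skeleton B)
  | A => .var (toNat A)

theorem Formula.subst_skeleton (A : Formula) : A.skeleton.subst ofNat = A := by
  induction A <;> simp_all [skeleton, PropFormula.subst, ofNat_toNat]

/-- A valuation of the variables of skeletons extends, by evaluating skeletons, to an `IsVal`
assignment. Hence the skeleton of `A` is a tautology, and `A` is a substitution instance of it. -/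
theorem Derivable.of_forall_isVal {A : Formula} (h : ∀ v, IsVal v → v A = true) :
    Derivable A := by
  have : A.skeleton.IsTautology := fun v =>
    h (fun B => B.skeleton.eval v) ⟨fun _ => rfl, fun _ _ => rfl, fun _ _ => rfl⟩
  simpa [subst_skeleton] using Derivable.cpl _ this ofNat

theorem IsVal.foldr_imp {v : Formula → Bool} (hv : IsVal v) (l : List Formula) (B : Formula) :
    v (l.foldr Formula.imp B) = true ↔ ((∀ C ∈ l, v C = true) → v B = true) := by
  induction l with
  | nil => simp
  | cons C l ih =>
    rw [List.foldr_cons, hv.imp, Bool.or_eq_true, ih]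
    cases h : v C <;> simp [h]

theorem Derivable.of_foldr_imp {l : List Formula} {B : Formula} (hl : ∀ C ∈ l, Derivable C)
    (h : Derivable (l.foldr Formula.imp B)) : Derivable B := by
  induction l with
  | nil => exact h
  | cons C l ih =>
    exact ih (fun D hD => hl D (List.mem_cons_of_mem _ hD)) (.ds _ _ (hl C List.mem_cons_self) h)

theorem Derivable.of_consequence {l : List Formula} {B : Formula} (hl : ∀ C ∈ l, Derivable C)
    (h : ∀ v, IsVal v → (∀ C ∈ l, v C = true) → v B = true) : Derivable B :=
  .of_foldr_imp hl (.of_forall_isVal fun v hv => (hv.foldr_imp l B).2 (h v hv))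

/-- A maximal consistent theory, given by its characteristic function. -/
structure IsTheory (w : Formula → Bool) : Prop extends IsVal w where
  derivable : ∀ A, Derivable A → w A = true

theorem isClosed_setOf_isVal : IsClosed {v : Formula → Bool | IsVal v} := by
  have : {v : Formula → Bool | IsVal v} =
      (⋂ A, {v | v (neg A) = !v A}) ∩ (⋂ A, ⋂ B, {v | v (and A B) = (v A && v B)}) ∩
        ⋂ A, ⋂ B, {v | v (or A B) = (v A || v B)} := by
    ext v
    simp only [Set.mem_inter_iff, Set.mem_iInter, Set.mem_ofPred_eq]
    exact ⟨fun h => ⟨⟨h.1, h.2⟩, h.3⟩, fun h => ⟨h.1.1, h.1.2, h.2⟩⟩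
  rw [this]
  have c2 (f : Bool → Bool → Bool) (A B : Formula) :
      Continuous fun v : Formula → Bool => f (v A) (v B) := by
    have hf : Continuous fun p : Bool × Bool => f p.1 p.2 := continuous_of_discreteTopology
    have hAB : Continuous fun v : Formula → Bool => (v A, v B) :=
      (continuous_apply A).prodMk (continuous_apply B)
    exact hf.comp hAB
  refine ((isClosed_iInter fun A => ?_).inter
    (isClosed_iInter fun A => isClosed_iInter fun B => ?_)).inter
    (isClosed_iInter fun A => isClosed_iInter fun B => ?_)
  · exact isClosed_eq (continuous_apply _) (c2 (fun a _ => !a) A A)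
  · exact isClosed_eq (continuous_apply _) (c2 _ A B)
  · exact isClosed_eq (continuous_apply _) (c2 _ A B)

/-- Lindenbaum's lemma by topology: the assignments that respect the connectives and refute `B` form
a closed, hence compact, subset of the Cantor space of all assignments. If no theory existed,
finitely many members of `Γ` and derivable formulas would already entail `B`. -/
theorem exists_isTheory {Γ : Set Formula} {B : Formula}
    (h : ∀ l : List Formula, (∀ C ∈ l, C ∈ Γ) → ¬ Derivable (l.foldr Formula.imp B)) :
    ∃ w, IsTheory w ∧ (∀ C ∈ Γ, w C = true) ∧ w B = false := by
  classical
  by_contra hne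
  have hK : IsCompact {v : Formula → Bool | IsVal v ∧ v B = false} :=
    (isClosed_setOf_isVal.inter
      (isClosed_eq (continuous_apply B) continuous_const)).isCompact
  obtain ⟨u, hu⟩ := hK.elim_finite_subfamily_closed
    (fun C : {C // C ∈ Γ ∨ Derivable C} => {v : Formula → Bool | v C = true})
    (fun C => isClosed_eq (continuous_apply _) continuous_const) (by
      rw [Set.eq_empty_iff_forall_notMem]
      rintro v ⟨⟨hv, hB⟩, hC⟩
      simp only [Set.mem_iInter, Set.mem_ofPred_eq, Subtype.forall] at hC
      exact hne ⟨v, ⟨hv, fun A hA => hC A (.inr hA)⟩, fun C hCΓ => hC C (.inl hCΓ), hB⟩)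
  let l := u.toList.map Subtype.val
  -- The finite subfamily splits: members of `Γ` stay as premises of the iterated implication, the
  -- others are derivable and can be discharged.
  refine h (l.filter (· ∈ Γ)) (fun C hC => by simpa using (List.mem_filter.1 hC).2) ?_
  refine Derivable.of_consequence (l := l.filter (· ∉ Γ)) (fun C hC => ?_) fun v hv hd => ?_
  · obtain ⟨h₁, h₂⟩ := List.mem_filter.1 hC
    obtain ⟨D, -, rfl⟩ := List.mem_map.1 h₁
    exact D.2.resolve_left (by simpa using h₂)
  · rw [hv.foldr_imp]
    intro hg
    by_contra hB
    rw [Set.eq_empty_iff_forall_notMem] at hu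
    refine hu v ⟨⟨hv, by simpa using hB⟩, ?_⟩
    simp only [Set.mem_iInter, Set.mem_ofPred_eq]
    intro C hC
    have hCl : C.1 ∈ l := List.mem_map_of_mem (Finset.mem_toList.2 hC)
    by_cases hΓ : C.1 ∈ Γ
    · exact hg _ (List.mem_filter.2 ⟨hCl, by simpa using hΓ⟩)
    · exact hd _ (List.mem_filter.2 ⟨hCl, by simpa using hΓ⟩)

namespace IsTheory

variable {w : Formula → Bool}

theorem box_of_foldr_imp (hw : IsTheory w) {l : List Formula} {B : Formula}
    (hl : ∀ C ∈ l, w (box C) = true) (h : w (box (l.foldr Formula.imp B)) = true) :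
    w (box B) = true := by
  induction l with
  | nil => exact h
  | cons C l ih =>
    refine ih (fun D hD => hl D (List.mem_cons_of_mem _ hD)) ?_
    have hk := hw.derivable _ (.k C (l.foldr Formula.imp B))
    have hC := hl C List.mem_cons_self
    rw [List.foldr_cons] at h
    simpa [hw.imp, h, hC] using hk

theorem dia (hw : IsTheory w) (A : Formula) : w (dia A) = !w (box (neg A)) := by
  simpa [hw.equ, hw.neg] using hw.derivable _ (.dual A)

/-- If finitely many `C` with `□C` in `w` led to `B`, necessitation and axiom K would put `□B` in
`w`; so the Lindenbaum lemma applies. -/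
theorem exists_of_box_eq_false (hw : IsTheory w) {B : Formula} (h : w (box B) = false) :
    ∃ u, IsTheory u ∧ (∀ C, w (box C) = true → u C = true) ∧ u B = false := by
  refine exists_isTheory (Γ := {C | w (box C) = true}) fun l hl hd => ?_
  have := hw.box_of_foldr_imp hl (hw.derivable _ (.nec _ hd))
  simp [h] at this

theorem impl (hw : IsTheory w) {A B : Formula} (h : w (arrow A B) = true) (hA : w A = true) :
    w B = true := by
  simpa [hw.imp, h, hA] using hw.derivable _ (.impl A B)

theorem cudl (hw : IsTheory w) {A B : Formula} (h : w (arrow (demod A) (demod B)) = true)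
    (hAB : w A = true → w B = true) : w (arrow A B) = true := by
  have := hw.derivable _ (.cudl A B)
  simp only [hw.imp, h, hw.or, hw.and, hw.neg] at this
  cases hA : w A <;> simp_all

theorem not_arrow_neg (hw : IsTheory w) {A B : Formula} (h : w (arrow A B) = true) :
    w (arrow A (neg B)) = false := by
  simpa [hw.neg] using hw.impl (hw.derivable _ (.b1 A B)) h

end IsTheory

/-! ### Closure properties of initial segments of Gödel numbers -/

namespace Formula

theorem demod_demod (A : Formula) : demod (demod A) = demod A := by
  induction A <;> simp_all [demod]

/-- Deleting modalities only lowers codes, because pairing is monotone in both arguments. Thus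
fragments given by a bound on codes are closed under demodalization. -/
theorem toNat_demod_le (A : Formula) : toNat (demod A) ≤ toNat A := by
  have hp {a b c d : ℕ} (h₁ : a ≤ c) (h₂ : b ≤ d) : Nat.pair a b ≤ Nat.pair c d :=
    (StrictMono.monotone (fun _ _ h => Nat.pair_lt_pair_left b h) h₁).trans
      (StrictMono.monotone (fun _ _ h => Nat.pair_lt_pair_right c h) h₂)
  induction A with
  | var n => exact le_rfl
  | neg A ih => simp only [demod, toNat]; omega
  | and A B ihA ihB | or A B ihA ihB | arrow A B ihA ihB =>
    have := hp ihA ihB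
    simp only [demod, toNat]; omega
  | box A ih | dia A ih => simp only [demod, toNat]; omega

theorem toNat_arrow_demod_le (A B : Formula) :
    toNat (arrow (demod A) (demod B)) ≤ toNat (arrow A B) :=
  toNat_demod_le (arrow A B)

theorem toNat_left_lt_arrow (A B : Formula) : toNat A < toNat (arrow A B) := by
  have := Nat.left_le_pair (toNat A) (toNat B)
  simp only [toNat]; omega

theorem toNat_right_lt_arrow (A B : Formula) : toNat B < toNat (arrow A B) := by
  have := Nat.right_le_pair (toNat A) (toNat B)
  simp only [toNat]; omega

theorem toNat_arrow_le_arrow_neg (A B : Formula) :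
    toNat (arrow A B) ≤ toNat (arrow A (neg B)) := by
  have := Nat.pair_lt_pair_right (toNat A) (show toNat B < 7 * toNat B + 1 by omega)
  simp only [toNat]; omega

end Formula

/-! ### Instances of Boethius' laws and coded finite models -/

/-- The pairs `A`, `B` for which `A → B` is an instance of one of the laws of Boethius. -/
def IsBoethius (A B : Formula) : Prop :=
  ∃ C D, A = arrow C D ∧ B = neg (arrow C (neg D)) ∨ A = arrow C (neg D) ∧ B = neg (arrow C D)

theorem IsBoethius.derivable {A B : Formula} (h : IsBoethius A B) : Derivable (arrow A B) := by
  obtain ⟨C, D, ⟨rfl, rfl⟩ | ⟨rfl, rfl⟩⟩ := h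
  exacts [.b1 C D, .b2 C D]

/-- The consequent of a law of Boethius is a negated implication, so it is never a double negation.
-/
theorem IsBoethius.not_neg {A B : Formula} (h : IsBoethius A B) : ¬ IsBoethius A (neg B) := by
  obtain ⟨C, D, ⟨rfl, rfl⟩ | ⟨rfl, rfl⟩⟩ := h <;> rintro ⟨C', D', ⟨-, h⟩ | ⟨-, h⟩⟩ <;> cases h

theorem IsBoethius.demod {A B : Formula} (h : IsBoethius A B) :
    IsBoethius A.demod B.demod := by
  obtain ⟨C, D, ⟨rfl, rfl⟩ | ⟨rfl, rfl⟩⟩ := h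
  exacts [⟨_, _, .inl ⟨rfl, rfl⟩⟩, ⟨_, _, .inr ⟨rfl, rfl⟩⟩]

theorem not_isBoethius_neg_self (A : Formula) : ¬ IsBoethius A (neg A) := by
  rintro ⟨C, D, ⟨rfl, h⟩ | ⟨rfl, h⟩⟩
  · have := congrArg sizeOf h
    simp at this
  · have := congrArg sizeOf h
    simp at this

theorem not_isBoethius_of_neg (A : Formula) : ¬ IsBoethius (neg A) A := by
  rintro ⟨C, D, ⟨h, -⟩ | ⟨h, -⟩⟩ <;> cases h

/-- Membership of a formula in the finite set of formulas that is coded by the binary digits of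
a natural number. -/
def Mem (t : ℕ) (A : Formula) : Prop := t.testBit (toNat A) = true

theorem Mem.toNat_lt {N t : ℕ} (ht : t < 2 ^ N) {A : Formula} (h : Mem t A) : toNat A < N := by
  by_contra hN
  have := Nat.testBit_lt_two_pow (ht.trans_le (Nat.pow_le_pow_right two_pos (not_lt.1 hN)))
  simp [Mem, this] at h

/-- `A` and `B` are related at `t`: the implication `A → B` is in `t` or is a law of Boethius. -/
def Related (t : ℕ) (A B : Formula) : Prop := IsBoethius A B ∨ Mem t (arrow A B)

/-- The conditions on a set `t` of formulas with Gödel numbers below `N` that concern a single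
world. -/
def Local (N t : ℕ) (A B : Formula) : Prop :=
  (toNat (neg A) < N → (Mem t (neg A) ↔ ¬ Mem t A)) ∧
  (toNat (and A B) < N → (Mem t (and A B) ↔ Mem t A ∧ Mem t B)) ∧
  (toNat (or A B) < N → (Mem t (or A B) ↔ Mem t A ∨ Mem t B)) ∧
  (Mem t (arrow A B) → B ≠ neg A ∧ A ≠ neg B ∧ (¬ Mem t A ∨ Mem t B) ∧ ¬ Related t A (neg B) ∧
    (Related t (demod A) (neg (demod B)) → Mem t A)) ∧
  (toNat (arrow A B) < N → IsBoethius A B ∨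
    Mem t (arrow (demod A) (demod B)) ∧ (¬ Mem t A ∨ Mem t B) → Mem t (arrow A B))

/-- Accessibility between sets of formulas with Gödel numbers below `N`. -/
def Accessible (N t s : ℕ) : Prop :=
  ∀ a < N, (Mem t (box (ofNat a)) → Mem s (ofNat a)) ∧
    (toNat (dia (ofNat a)) < N → Mem s (ofNat a) → Mem t (dia (ofNat a)))

/-- The set `t` is one of the worlds coded by `M`. -/
def World (N M t : ℕ) : Prop := t < 2 ^ N ∧ M.testBit t = true

/-- Every formula `□A` outside `t` and every formula `◇A` in `t` has a witness. -/
def Saturated (N M t : ℕ) (A : Formula) : Prop :=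
  (toNat (box A) < N → ¬ Mem t (box A) →
    ∃ s < 2 ^ N, M.testBit s = true ∧ Accessible N t s ∧ ¬ Mem s A) ∧
  (Mem t (dia A) → ∃ s < 2 ^ N, M.testBit s = true ∧ Accessible N t s ∧ Mem s A)

/-- `M` codes a finite model for the formulas with Gödel numbers below `N`. -/
def IsModel (N M : ℕ) : Prop :=
  ∀ t < 2 ^ N, M.testBit t = true →
    (∀ a < N, ∀ b < N, Local N t (ofNat a) (ofNat b)) ∧ ∀ a < N, Saturated N M t (ofNat a)

/-- Truth of a formula at a world of the model coded by `M`. -/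
def Eval (N M : ℕ) : ℕ → Formula → Prop
  | t, .var n => Mem t (var n)
  | t, .neg A => ¬ Eval N M t A
  | t, .and A B => Eval N M t A ∧ Eval N M t B
  | t, .or A B => Eval N M t A ∨ Eval N M t B
  | t, .arrow A B => Mem t (arrow A B) ∨ ¬ toNat (arrow A B) < N ∧
      (Eval N M t A → Eval N M t B) ∧ Related t (demod A) (demod B)
  | t, .box A => ∀ s, World N M s → Accessible N t s → Eval N M s A
  | t, .dia A => ∃ s, World N M s ∧ Accessible N t s ∧ Eval N M s A

/-! ### Soundness of the calculus for coded finite models -/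

section Soundness

variable {N M : ℕ}

theorem IsModel.isLocal (hM : IsModel N M) {t : ℕ} (ht : World N M t) {A B : Formula}
    (hA : toNat A < N) (hB : toNat B < N) : Local N t A B := by
  simpa only [ofNat_toNat] using (hM t ht.1 ht.2).1 _ hA _ hB

theorem IsModel.local_arrow (hM : IsModel N M) {t : ℕ} (ht : World N M t) {A B : Formula}
    (h : toNat (arrow A B) < N) : Local N t A B :=
  hM.isLocal ht ((toNat_left_lt_arrow A B).trans h) ((toNat_right_lt_arrow A B).trans h)

theorem IsModel.saturated (hM : IsModel N M) {t : ℕ} (ht : World N M t) {A : Formula}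
    (hA : toNat A < N) : Saturated N M t A := by
  simpa only [ofNat_toNat] using (hM t ht.1 ht.2).2 _ hA

theorem Accessible.box {t s : ℕ} (h : Accessible N t s) {A : Formula} (hA : toNat A < N)
    (hbox : Mem t (box A)) : Mem s A := by
  have := (h _ hA).1
  rw [ofNat_toNat] at this
  exact this hbox

theorem Accessible.dia {t s : ℕ} (h : Accessible N t s) {A : Formula}
    (hA : toNat (dia A) < N) (hs : Mem s A) : Mem t (dia A) := by
  have := (h (toNat A) (by simp only [Formula.toNat] at hA; omega)).2
  rw [ofNat_toNat] at this
  exact this hA hs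

/-- The truth lemma for the fragment. Implications are true by membership there; for the modalities,
one direction is accessibility and the other is saturation. -/
theorem IsModel.eval_iff_mem (hM : IsModel N M) {A : Formula} (hA : toNat A < N) {t : ℕ}
    (ht : World N M t) : Eval N M t A ↔ Mem t A := by
  induction A generalizing t with
  | var n => exact Iff.rfl
  | neg A ih =>
    have hA' : toNat A < N := by simp only [Formula.toNat] at hA; omega
    rw [Eval, ih hA' ht, (hM.isLocal ht hA' hA').1 hA]
  | and A B ihA ihB =>
    have h₁ := Nat.left_le_pair (toNat A) (toNat B)
    have h₂ := Nat.right_le_pair (toNat A) (toNat B)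
    have hA' : toNat A < N := by simp only [Formula.toNat] at hA; omega
    have hB' : toNat B < N := by simp only [Formula.toNat] at hA; omega
    rw [Eval, ihA hA' ht, ihB hB' ht, (hM.isLocal ht hA' hB').2.1 hA]
  | or A B ihA ihB =>
    have h₁ := Nat.left_le_pair (toNat A) (toNat B)
    have h₂ := Nat.right_le_pair (toNat A) (toNat B)
    have hA' : toNat A < N := by simp only [Formula.toNat] at hA; omega
    have hB' : toNat B < N := by simp only [Formula.toNat] at hA; omega
    rw [Eval, ihA hA' ht, ihB hB' ht, (hM.isLocal ht hA' hB').2.2.1 hA]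
  | arrow A B => simp only [Eval, hA, not_true_eq_false, false_and, or_false]
  | box A ih =>
    have hA' : toNat A < N := by simp only [Formula.toNat] at hA; omega
    rw [Eval]
    refine ⟨fun h => ?_, fun h s hs hts => (ih hA' hs).2 (Accessible.box hts hA' h)⟩
    by_contra hbox
    obtain ⟨s, hs, hsM, hts, hns⟩ := (hM.saturated ht hA').1 hA hbox
    exact hns ((ih hA' ⟨hs, hsM⟩).1 (h s ⟨hs, hsM⟩ hts))
  | dia A ih =>
    have hA' : toNat A < N := by simp only [Formula.toNat] at hA; omega
    rw [Eval]
    refine ⟨fun ⟨s, hs, hts, h⟩ => Accessible.dia hts hA ((ih hA' hs).1 h), fun h => ?_⟩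
    obtain ⟨s, hs, hsM, hts, h⟩ := (hM.saturated ht hA').2 h
    exact ⟨s, ⟨hs, hsM⟩, hts, (ih hA' ⟨hs, hsM⟩).2 h⟩

theorem IsModel.eval_impl (hM : IsModel N M) {t : ℕ} (ht : World N M t) {A B : Formula}
    (h : Eval N M t (arrow A B)) (hA : Eval N M t A) : Eval N M t B := by
  obtain h | h := h
  · have hN := h.toNat_lt ht.1
    rw [hM.eval_iff_mem ((toNat_left_lt_arrow A B).trans hN) ht] at hA
    rw [hM.eval_iff_mem ((toNat_right_lt_arrow A B).trans hN) ht]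
    exact ((hM.local_arrow ht hN).2.2.2.1 h).2.2.1.resolve_left (not_not.2 hA)
  · exact h.2.1 hA

/-- The mixed case uses the coding: if `A → ¬B` is in `t`, then `A → B` also lies in the fragment,
so as a law of Boethius it is in `t`, and the local conditions forbid the pair. -/
theorem IsModel.not_related_neg (hM : IsModel N M) {t : ℕ} (ht : World N M t) {A B : Formula}
    (h : Related t A B) : ¬ Related t A (neg B) := by
  obtain h | h := h
  · rintro (h' | h')
    · exact h.not_neg h'
    · have hN := (toNat_arrow_le_arrow_neg A B).trans_lt (h'.toNat_lt ht.1)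
      have hL := hM.local_arrow ht hN
      exact (hL.2.2.2.1 (hL.2.2.2.2 hN (.inl h))).2.2.2.1 (.inr h')
  · exact ((hM.local_arrow ht (h.toNat_lt ht.1)).2.2.2.1 h).2.2.2.1

/-- If both implications were true, `A` would be false. When only `A → B` lies in the fragment, the
last requirement that `Local` puts on its members forces `A` to be true. Only `A → ¬B` in the
fragment is impossible, as its code is the larger one. When both lie outside, demodalization reduces
the claim to `IsModel.not_related_neg`. -/
theorem IsModel.not_eval_arrow_neg (hM : IsModel N M) {t : ℕ} (ht : World N M t)
    {A B : Formula} (h : Eval N M t (arrow A B)) : ¬ Eval N M t (arrow A (neg B)) := by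
  intro h'
  have hA : ¬ Eval N M t A := fun hA => hM.eval_impl ht h' hA (hM.eval_impl ht h hA)
  rw [Eval] at h h'
  obtain h | h := h
  · have hN := h.toNat_lt ht.1
    have hL := (hM.local_arrow ht hN).2.2.2.1 h
    obtain h' | h' := h'
    · exact hL.2.2.2.1 (.inr h')
    · exact hA ((hM.eval_iff_mem ((toNat_left_lt_arrow A B).trans hN) ht).2 (hL.2.2.2.2 h'.2.2))
  · obtain h' | h' := h'
    · exact h.1 ((toNat_arrow_le_arrow_neg A B).trans_lt (h'.toNat_lt ht.1))
    · exact hM.not_related_neg ht h.2.2 h'.2.2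

/-- Outside the fragment, relatedness is automatic because demodalization preserves the shape of the
law, and the material part is `IsModel.not_eval_arrow_neg`. -/
theorem IsModel.eval_of_isBoethius (hM : IsModel N M) {t : ℕ} (ht : World N M t)
    {A B : Formula} (h : IsBoethius A B) : Eval N M t (arrow A B) := by
  by_cases hN : toNat (arrow A B) < N
  · exact .inl ((hM.local_arrow ht hN).2.2.2.2 hN (.inl h))
  · refine .inr ⟨hN, ?_, .inl h.demod⟩
    obtain ⟨C, D, ⟨rfl, rfl⟩ | ⟨rfl, rfl⟩⟩ := h
    · exact hM.not_eval_arrow_neg ht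
    · exact fun h h' => hM.not_eval_arrow_neg ht h' h

/-- If `A → B` lies in the fragment, so does its demodalization, and the local closure condition
applies. Otherwise truth outside the fragment is what CUDL demands, since demodalization is
idempotent. -/
theorem IsModel.eval_cudl (hM : IsModel N M) {t : ℕ} (ht : World N M t) {A B : Formula}
    (h : Eval N M t (arrow (demod A) (demod B))) (hAB : Eval N M t A → Eval N M t B) :
    Eval N M t (arrow A B) := by
  rw [Eval] at h ⊢
  simp only [demod_demod] at h
  by_cases hN : toNat (arrow A B) < N
  · have h' := h.resolve_right fun h' => h'.1 ((toNat_arrow_demod_le A B).trans_lt hN)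
    refine .inl ((hM.local_arrow ht hN).2.2.2.2 hN (.inr ⟨h', ?_⟩))
    rwa [hM.eval_iff_mem ((toNat_left_lt_arrow A B).trans hN) ht,
      hM.eval_iff_mem ((toNat_right_lt_arrow A B).trans hN) ht, imp_iff_not_or] at hAB
  · exact .inr ⟨hN, hAB, h.elim .inr fun h => h.2.2⟩

theorem eval_subst {t : ℕ} (σ : ℕ → Formula) (φ : PropFormula) [∀ A, Decidable (Eval N M t A)] :
    Eval N M t (φ.subst σ) ↔ φ.eval (fun n => decide (Eval N M t (σ n))) = true := by
  induction φ <;> simp_all [PropFormula.subst, PropFormula.eval, Eval]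

theorem eval_imp {t : ℕ} {A B : Formula} :
    Eval N M t (imp A B) ↔ (Eval N M t A → Eval N M t B) := by
  rw [Formula.imp, Eval, Eval, imp_iff_not_or]

theorem IsModel.sound (hM : IsModel N M) {A : Formula} (hA : Derivable A) {t : ℕ}
    (ht : World N M t) : Eval N M t A := by
  induction hA generalizing t with
  | cpl φ hφ σ =>
    classical
    exact (eval_subst σ φ).2 (hφ _)
  | a1 A =>
    rw [Eval]
    rintro (h | h)
    · exact ((hM.local_arrow ht (h.toNat_lt ht.1)).2.2.2.1 h).1 rfl
    · obtain h | h := h.2.2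
      · exact not_isBoethius_neg_self _ h
      · exact ((hM.local_arrow ht (h.toNat_lt ht.1)).2.2.2.1 h).1 rfl
  | a2 A =>
    rw [Eval]
    rintro (h | h)
    · exact ((hM.local_arrow ht (h.toNat_lt ht.1)).2.2.2.1 h).2.1 rfl
    · obtain h | h := h.2.2
      · exact not_isBoethius_of_neg _ h
      · exact ((hM.local_arrow ht (h.toNat_lt ht.1)).2.2.2.1 h).2.1 rfl
  | b1 A B => exact hM.eval_of_isBoethius ht ⟨_, _, .inl ⟨rfl, rfl⟩⟩
  | b2 A B => exact hM.eval_of_isBoethius ht ⟨_, _, .inr ⟨rfl, rfl⟩⟩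
  | impl A B => rw [eval_imp, eval_imp]; exact hM.eval_impl ht
  | dual A =>
    simp only [equ, Eval]
    push Not
    rw [and_self, or_iff_not_imp_left]
    push Not
    exact id
  | k A B =>
    simp only [eval_imp, Eval]
    exact fun h hA s hs hts => h s hs hts (hA s hs hts)
  | cudl A B =>
    rw [eval_imp]
    intro h
    simp only [Eval.eq_4, Eval.eq_3, Eval.eq_2]
    by_cases hAB : Eval N M t A → Eval N M t B
    · exact .inl (hM.eval_cudl ht h hAB)
    · exact .inr (by simpa using hAB)
  | ds A B _ _ ihA ihAB => exact eval_imp.1 (ihAB ht) (ihA ht)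
  | nec A _ ih => exact fun s hs _ => ih hs

end Soundness

/-! ### Completeness: the model of traces of theories -/

section Completeness

/-- The set of formulas with Gödel numbers below `N` that belong to a theory. -/
def trace (N : ℕ) (w : Formula → Bool) : ℕ := Nat.ofBits fun i : Fin N => w (ofNat i)

theorem trace_lt (N : ℕ) (w : Formula → Bool) : trace N w < 2 ^ N := Nat.ofBits_lt_two_pow _

theorem mem_trace {N : ℕ} {w : Formula → Bool} {A : Formula} :
    Mem (trace N w) A ↔ toNat A < N ∧ w A = true := by
  refine ⟨fun h => ?_, fun ⟨hN, h⟩ => ?_⟩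
  · have hN := h.toNat_lt (trace_lt N w)
    rw [Mem, trace, Nat.testBit_ofBits_lt _ _ hN, ofNat_toNat] at h
    exact ⟨hN, h⟩
  · rw [Mem, trace, Nat.testBit_ofBits_lt _ _ hN, ofNat_toNat]
    exact h

variable {N : ℕ} {w : Formula → Bool}

theorem IsTheory.arrow_of_related (hw : IsTheory w) {A B : Formula}
    (h : Related (trace N w) A B) : w (arrow A B) = true :=
  h.elim (fun h => hw.derivable _ h.derivable) fun h => (mem_trace.1 h).2

/-- Each local condition is a consequence of the axioms at `w`; those relating an implication to its
demodalization come from CUDL. -/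
theorem IsTheory.isLocal_trace (hw : IsTheory w) (A B : Formula) : Local N (trace N w) A B := by
  have hand₁ := Nat.left_le_pair (toNat A) (toNat B)
  have hand₂ := Nat.right_le_pair (toNat A) (toNat B)
  refine ⟨fun h => ?_, fun h => ?_, fun h => ?_, fun h => ?_, fun h => ?_⟩
  · have hA : toNat A < N := by simp only [Formula.toNat] at h; omega
    simp [mem_trace, h, hA, hw.neg]
  · have hA : toNat A < N := by simp only [Formula.toNat] at h; omega
    have hB : toNat B < N := by simp only [Formula.toNat] at h; omega
    simp [mem_trace, h, hA, hB, hw.and]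
  · have hA : toNat A < N := by simp only [Formula.toNat] at h; omega
    have hB : toNat B < N := by simp only [Formula.toNat] at h; omega
    simp [mem_trace, h, hA, hB, hw.or]
  · obtain ⟨hN, h⟩ := mem_trace.1 h
    have hA := (toNat_left_lt_arrow A B).trans hN
    have hB := (toNat_right_lt_arrow A B).trans hN
    refine ⟨?_, ?_, ?_, fun h' => ?_, fun h' => mem_trace.2 ⟨hA, ?_⟩⟩
    · rintro rfl
      have := hw.derivable _ (.a1 A)
      simp [hw.neg, h] at this
    · rintro rfl
      have := hw.derivable _ (.a2 B)
      simp [hw.neg, h] at this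
    · rw [← imp_iff_not_or, mem_trace, mem_trace]
      exact fun h' => ⟨hB, hw.impl h h'.2⟩
    · have := hw.not_arrow_neg h
      rw [hw.arrow_of_related h'] at this
      cases this
    · by_contra hA'
      -- With `A` false, `A ⊃ ¬B` holds vacuously, so CUDL lifts `d(A) → ¬d(B)` to `A → ¬B`, against
      -- Boethius' law for `A → B`.
      have := hw.cudl (A := A) (B := neg B) (hw.arrow_of_related h') fun h => absurd h hA'
      rw [hw.not_arrow_neg h] at this
      cases this
  · have hA := (toNat_left_lt_arrow A B).trans h
    rintro (h' | ⟨h', hAB⟩)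
    · exact mem_trace.2 ⟨h, hw.derivable _ h'.derivable⟩
    · refine mem_trace.2 ⟨h, hw.cudl (mem_trace.1 h').2 fun h => ?_⟩
      exact (mem_trace.1 (hAB.resolve_left (not_not.2 (mem_trace.2 ⟨hA, h⟩)))).2

theorem IsTheory.accessible_trace (hw : IsTheory w) {u : Formula → Bool} (hu : IsTheory u)
    (h : ∀ C, w (box C) = true → u C = true) : Accessible N (trace N w) (trace N u) := by
  refine fun a ha => ⟨fun hb => mem_trace.2 ⟨by rwa [toNat_ofNat], h _ (mem_trace.1 hb).2⟩,
    fun hd hu' => mem_trace.2 ⟨hd, ?_⟩⟩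
  rw [hw.dia]
  -- If `◇A` were false at `w`, then `□¬A` would be true there and `¬A` true at `u`.
  by_contra hbox
  have := h (neg (ofNat a)) (by simpa using hbox)
  simp [hu.neg, (mem_trace.1 hu').2] at this

open Classical in
/-- The set of all traces of theories. -/
noncomputable def canonical (N : ℕ) : ℕ :=
  Nat.ofBits fun i : Fin (2 ^ N) => decide (∃ w, IsTheory w ∧ trace N w = i)

theorem canonical_lt (N : ℕ) : canonical N < 2 ^ 2 ^ N := Nat.ofBits_lt_two_pow _

theorem testBit_canonical {t : ℕ} (ht : t < 2 ^ N) :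
    (canonical N).testBit t = true ↔ ∃ w, IsTheory w ∧ trace N w = t := by
  simp [canonical, Nat.testBit_ofBits_lt _ _ ht]

theorem IsTheory.testBit_canonical (hw : IsTheory w) :
    (canonical N).testBit (trace N w) = true :=
  (MBCL.testBit_canonical (trace_lt N w)).2 ⟨w, hw, rfl⟩

theorem isModel_canonical (N : ℕ) : IsModel N (canonical N) := by
  intro t ht htM
  obtain ⟨w, hw, rfl⟩ := (testBit_canonical ht).1 htM
  refine ⟨fun a _ b _ => hw.isLocal_trace _ _, fun a ha => ⟨fun hN hbox => ?_, fun hdia => ?_⟩⟩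
  · have : w (box (ofNat a)) = false := by
      by_contra h
      exact hbox (mem_trace.2 ⟨hN, by simpa using h⟩)
    obtain ⟨u, hu, hwu, h⟩ := hw.exists_of_box_eq_false this
    exact ⟨_, trace_lt N u, hu.testBit_canonical, hw.accessible_trace hu hwu,
      fun h' => by simp [(mem_trace.1 h').2] at h⟩
  · have := (mem_trace.1 hdia).2
    rw [hw.dia, Bool.not_eq_true'] at this
    obtain ⟨u, hu, hwu, h⟩ := hw.exists_of_box_eq_false this
    refine ⟨_, trace_lt N u, hu.testBit_canonical, hw.accessible_trace hu hwu,
      mem_trace.2 ⟨by rwa [toNat_ofNat], ?_⟩⟩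
    simpa [hu.neg] using h

/-- `M` codes a countermodel to `A` for the formulas with Gödel numbers below `N`. -/
def IsCountermodel (N M : ℕ) (A : Formula) : Prop :=
  IsModel N M ∧ ∃ t < 2 ^ N, M.testBit t = true ∧ ¬ Mem t A

/-- The successor in the bound puts `A` itself into the fragment, so that its truth at a world is
membership. -/
theorem derivable_iff_not_exists_isCountermodel (A : Formula) :
    Derivable A ↔ ¬ ∃ M < 2 ^ 2 ^ (toNat A + 1), IsCountermodel (toNat A + 1) M A := by
  constructor
  · rintro h ⟨M, -, hM, t, ht, htM, hA⟩
    exact hA ((hM.eval_iff_mem (Nat.lt_succ_self _) ⟨ht, htM⟩).1 (hM.sound h ⟨ht, htM⟩))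
  · intro h
    by_contra hA
    obtain ⟨w, hw, -, hwA⟩ := exists_isTheory (Γ := ∅) (B := A) fun l hl => by
      rwa [List.eq_nil_iff_forall_not_mem.2 hl]
    refine h ⟨_, canonical_lt _, isModel_canonical _, _, trace_lt _ w, hw.testBit_canonical, ?_⟩
    intro h
    simp [(mem_trace.1 h).2] at hwA

end Completeness

end MBCL

/-! ### Primitive recursive predicates: bounded quantifiers, connectives, binary digits -/

theorem PrimrecPred.forall_lt_of {α : Type*} [Primcodable α] {f : α → ℕ} (hf : Primrec f)
    {p : α → ℕ → Prop} (hp : PrimrecPred fun x : α × ℕ => p x.1 x.2) :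
    PrimrecPred fun a => ∀ n < f a, p a n :=
  ((PrimrecRel.forall_mem_list (R := fun x a => p a x)
    (hp.comp (Primrec.snd.pair Primrec.fst))).comp
      (Primrec.list_range.comp hf) Primrec.id).of_eq (by simp)

theorem PrimrecPred.exists_lt_of {α : Type*} [Primcodable α] {f : α → ℕ} (hf : Primrec f)
    {p : α → ℕ → Prop} (hp : PrimrecPred fun x : α × ℕ => p x.1 x.2) :
    PrimrecPred fun a => ∃ n < f a, p a n :=
  ((PrimrecRel.exists_mem_list (R := fun x a => p a x)
    (hp.comp (Primrec.snd.pair Primrec.fst))).comp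
      (Primrec.list_range.comp hf) Primrec.id).of_eq (by simp)

theorem PrimrecPred.imp {α : Type*} [Primcodable α] {p q : α → Prop} (hp : PrimrecPred p)
    (hq : PrimrecPred q) : PrimrecPred fun a => p a → q a :=
  (hp.not.or hq).of_eq fun _ => imp_iff_not_or.symm

theorem PrimrecPred.iff {α : Type*} [Primcodable α] {p q : α → Prop} (hp : PrimrecPred p)
    (hq : PrimrecPred q) : PrimrecPred fun a => p a ↔ q a :=
  ((hp.imp hq).and (hq.imp hp)).of_eq fun _ => iff_def.symm

theorem Primrec.nat_pow : Primrec₂ ((· ^ ·) : ℕ → ℕ → ℕ) :=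
  Primrec₂.unpaired'.1 Nat.Primrec.pow

theorem Primrec.nat_testBit : PrimrecRel fun m n : ℕ => m.testBit n = true :=
  ((Primrec.eq (α := ℕ)).comp
    (Primrec.nat_mod.comp
      (Primrec.nat_div.comp Primrec.fst
        (Primrec.nat_pow.comp (Primrec.const 2) Primrec.snd)) (Primrec.const 2))
    (Primrec.const 1)).of_eq fun x => by simp [Nat.testBit_eq_decide_div_mod_eq]

namespace MBCL

open Formula

/-! ### Primitive recursiveness of the syntax and of demodalization -/

namespace Formula

theorem primrec_toNat : Primrec toNat := Primrec.of_equiv (e := equivNat)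

theorem primrec_ofNat : Primrec ofNat := Primrec.of_equiv_symm (e := equivNat)

theorem primrec_of_toNat {α : Type*} [Primcodable α] {f : α → Formula}
    (h : Primrec fun a => toNat (f a)) : Primrec f :=
  (primrec_ofNat.comp h).of_eq fun _ => ofNat_toNat _

section

variable {α : Type*} [Primcodable α] {f g : α → Formula}

theorem primrec_unary {k l : ℕ} (hf : Primrec f) : Primrec fun a => k * toNat (f a) + l :=
  Primrec.nat_add.comp (Primrec.nat_mul.comp (Primrec.const k) (primrec_toNat.comp hf))
    (Primrec.const l)

theorem primrec_binary {k l : ℕ} (hf : Primrec f) (hg : Primrec g) :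
    Primrec fun a => k * Nat.pair (toNat (f a)) (toNat (g a)) + l :=
  Primrec.nat_add.comp (Primrec.nat_mul.comp (Primrec.const k)
    (Primrec₂.natPair.comp (primrec_toNat.comp hf) (primrec_toNat.comp hg))) (Primrec.const l)

theorem primrec_neg (hf : Primrec f) : Primrec fun a => neg (f a) :=
  primrec_of_toNat (primrec_unary hf)

theorem primrec_and (hf : Primrec f) (hg : Primrec g) : Primrec fun a => and (f a) (g a) :=
  primrec_of_toNat (primrec_binary hf hg)

theorem primrec_or (hf : Primrec f) (hg : Primrec g) : Primrec fun a => or (f a) (g a) :=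
  primrec_of_toNat (primrec_binary hf hg)

theorem primrec_arrow (hf : Primrec f) (hg : Primrec g) : Primrec fun a => arrow (f a) (g a) :=
  primrec_of_toNat (primrec_binary hf hg)

theorem primrec_box (hf : Primrec f) : Primrec fun a => box (f a) :=
  primrec_of_toNat (primrec_unary hf)

theorem primrec_dia (hf : Primrec f) : Primrec fun a => dia (f a) :=
  primrec_of_toNat (primrec_unary hf)

end

/-- One step of the course-of-values recursion that computes demodalization on Gödel numbers. -/
def demodStep (l : List ℕ) : ℕ :=
  if l.length % 7 = 0 then l.length
  else if 4 < l.length % 7 then l.getD (l.length / 7) 0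
  else if l.length % 7 = 1 then 7 * l.getD (l.length / 7) 0 + 1
  else 7 * Nat.pair (l.getD (l.length / 7).unpair.1 0) (l.getD (l.length / 7).unpair.2 0) +
    l.length % 7

theorem primrec_demodStep : Primrec demodStep := by
  have hl : Primrec (List.length (α := ℕ)) := Primrec.list_length
  have hm : Primrec fun l : List ℕ => l.length % 7 := Primrec.nat_mod.comp hl (Primrec.const 7)
  have hd : Primrec fun l : List ℕ => l.length / 7 := Primrec.nat_div.comp hl (Primrec.const 7)
  have hu := Primrec.unpair.comp hd
  have hget {i : List ℕ → ℕ} (hi : Primrec i) : Primrec fun l : List ℕ => l.getD (i l) 0 :=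
    (Primrec.list_getD 0).comp Primrec.id hi
  refine Primrec.ite (Primrec.eq.comp hm (Primrec.const 0)) hl ?_
  refine Primrec.ite (Primrec.nat_lt.comp (Primrec.const 4) hm) (hget hd) ?_
  refine Primrec.ite (Primrec.eq.comp hm (Primrec.const 1)) ?_ ?_
  · exact Primrec.nat_add.comp (Primrec.nat_mul.comp (Primrec.const 7) (hget hd)) (Primrec.const 1)
  · exact Primrec.nat_add.comp (Primrec.nat_mul.comp (Primrec.const 7)
      (Primrec₂.natPair.comp (hget (Primrec.fst.comp hu)) (hget (Primrec.snd.comp hu)))) hm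

/-- The list holds the results for all smaller codes, so its length is the code being treated.
Immediate subformulas have smaller codes, hence the default value `0` is never used. -/
theorem demodStep_map_range (A : Formula) :
    demodStep ((List.range (toNat A)).map fun n => toNat (demod (ofNat n))) =
      toNat (demod A) := by
  have hget {n i : ℕ} (h : i < n) :
      ((List.range n).map fun n => toNat (demod (ofNat n))).getD i 0 =
        toNat (demod (ofNat i)) := by
    simp [List.getD_eq_getElem?_getD, h]
  have hget' {n : ℕ} {A : Formula} (h : toNat A < n) :
      ((List.range n).map fun n => toNat (demod (ofNat n))).getD (toNat A) 0 =
        toNat (demod A) := by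
    rw [hget h, ofNat_toNat]
  have key (k : ℕ) {l : ℕ} (hl : l < 7) : (7 * k + l) % 7 = l ∧ (7 * k + l) / 7 = k := by omega
  have hbin (A B : Formula) {l : ℕ} (hl : l < 7) :
      toNat A < 7 * Nat.pair (toNat A) (toNat B) + (l + 1) ∧
      toNat B < 7 * Nat.pair (toNat A) (toNat B) + (l + 1) := by
    have h₁ := Nat.left_le_pair (toNat A) (toNat B)
    have h₂ := Nat.right_le_pair (toNat A) (toNat B)
    omega
  rw [demodStep, List.length_map, List.length_range]
  cases A with
  | var n => simp [toNat, demod]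
  | neg A =>
    rw [toNat, (key _ (by norm_num)).1, (key _ (by norm_num)).2, hget' (by omega)]
    simp [toNat, demod]
  | box A | dia A =>
    rw [toNat, (key _ (by norm_num)).1, (key _ (by norm_num)).2, hget' (by omega)]
    simp [demod]
  | and A B | or A B | arrow A B =>
    rw [toNat, (key _ (by norm_num)).1, (key _ (by norm_num)).2, Nat.unpair_pair,
      hget' (hbin A B (by norm_num)).1, hget' (hbin A B (by norm_num)).2]
    simp [toNat, demod]

theorem primrec_demod : Primrec demod := by
  -- `Primrec.nat_strong_rec` treats functions with a parameter; the `Unit` argument is a dummy one.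
  have h : Primrec₂ fun (_ : Unit) n => toNat (demod (ofNat n)) := by
    refine Primrec.nat_strong_rec _ (g := fun _ l => some (demodStep l))
      (Primrec.option_some.comp (primrec_demodStep.comp Primrec.snd)) fun _ n => ?_
    have := demodStep_map_range (ofNat n)
    rw [toNat_ofNat] at this
    rw [this]
  refine primrec_of_toNat ?_
  exact (h.comp (Primrec.const ()) primrec_toNat).of_eq fun A => by rw [ofNat_toNat]

end Formula

/-! ### Primitive recursiveness of the countermodel conditions -/

section

variable {α : Type*} [Primcodable α] {N M t s : α → ℕ} {A B : α → Formula}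

theorem primrecPred_mem (ht : Primrec t) (hA : Primrec A) :
    PrimrecPred fun a => Mem (t a) (A a) :=
  Primrec.nat_testBit.comp ht (primrec_toNat.comp hA)

theorem primrecPred_toNat_lt (hN : Primrec N) (hA : Primrec A) :
    PrimrecPred fun a => toNat (A a) < N a :=
  Primrec.nat_lt.comp (primrec_toNat.comp hA) hN

/-- Both constituents are proper subformulas of `A`, so the search for them is bounded by the code
of `A`. -/
theorem isBoethius_iff (A B : Formula) : IsBoethius A B ↔
    ∃ c < toNat A, ∃ d < toNat A,
      A = arrow (ofNat c) (ofNat d) ∧ B = neg (arrow (ofNat c) (neg (ofNat d))) ∨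
      A = arrow (ofNat c) (neg (ofNat d)) ∧ B = neg (arrow (ofNat c) (ofNat d)) := by
  constructor
  · rintro ⟨C, D, h⟩
    have hA : toNat C < toNat A ∧ toNat D < toNat A := by
      obtain ⟨rfl, -⟩ | ⟨rfl, -⟩ := h
      · exact ⟨toNat_left_lt_arrow _ _, toNat_right_lt_arrow _ _⟩
      · refine ⟨toNat_left_lt_arrow _ _, lt_of_le_of_lt ?_ (toNat_right_lt_arrow _ _)⟩
        simp only [Formula.toNat]; omega
    exact ⟨_, hA.1, _, hA.2, by simpa only [ofNat_toNat] using h⟩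
  · rintro ⟨c, -, d, -, h⟩
    exact ⟨_, _, h⟩

theorem primrecPred_eq (hA : Primrec A) (hB : Primrec B) : PrimrecPred fun a => A a = B a :=
  Primrec.eq.comp hA hB

theorem primrecPred_isBoethius (hA : Primrec A) (hB : Primrec B) :
    PrimrecPred fun a => IsBoethius (A a) (B a) := by
  refine PrimrecPred.of_eq ?_ fun a => (isBoethius_iff (A a) (B a)).symm
  refine .exists_lt_of (primrec_toNat.comp hA) ?_
  refine .exists_lt_of (primrec_toNat.comp (hA.comp .fst)) ?_
  have hC : Primrec fun x : (α × ℕ) × ℕ => ofNat x.1.2 :=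
    primrec_ofNat.comp (Primrec.snd.comp .fst)
  have hD : Primrec fun x : (α × ℕ) × ℕ => ofNat x.2 := primrec_ofNat.comp .snd
  have hA' : Primrec fun x : (α × ℕ) × ℕ => A x.1.1 := hA.comp (Primrec.fst.comp .fst)
  have hB' : Primrec fun x : (α × ℕ) × ℕ => B x.1.1 := hB.comp (Primrec.fst.comp .fst)
  have h₁ := primrec_arrow hC hD
  have h₂ := primrec_arrow hC (primrec_neg hD)
  exact ((primrecPred_eq hA' h₁).and (primrecPred_eq hB' (primrec_neg h₂))).or
    ((primrecPred_eq hA' h₂).and (primrecPred_eq hB' (primrec_neg h₁)))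

theorem primrecPred_related (ht : Primrec t) (hA : Primrec A) (hB : Primrec B) :
    PrimrecPred fun a => Related (t a) (A a) (B a) :=
  (primrecPred_isBoethius hA hB).or (primrecPred_mem ht (primrec_arrow hA hB))

theorem primrecPred_local (hN : Primrec N) (ht : Primrec t) (hA : Primrec A) (hB : Primrec B) :
    PrimrecPred fun a => Local (N a) (t a) (A a) (B a) := by
  have mA := primrecPred_mem ht hA
  have mB := primrecPred_mem ht hB
  have dA := primrec_demod.comp hA
  have dB := primrec_demod.comp hB
  have hAB := primrec_arrow hA hB
  have mAB := primrecPred_mem ht hAB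
  refine .and ?_ (.and ?_ (.and ?_ (.and ?_ ?_)))
  · exact .imp (primrecPred_toNat_lt hN (primrec_neg hA))
      (.iff (primrecPred_mem ht (primrec_neg hA)) mA.not)
  · exact .imp (primrecPred_toNat_lt hN (primrec_and hA hB))
      (.iff (primrecPred_mem ht (primrec_and hA hB)) (mA.and mB))
  · exact .imp (primrecPred_toNat_lt hN (primrec_or hA hB))
      (.iff (primrecPred_mem ht (primrec_or hA hB)) (mA.or mB))
  · exact .imp mAB (.and (primrecPred_eq hB (primrec_neg hA)).not
      (.and (primrecPred_eq hA (primrec_neg hB)).not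
        (.and (mA.not.or mB) (.and (primrecPred_related ht hA (primrec_neg hB)).not
          (.imp (primrecPred_related ht dA (primrec_neg dB)) mA)))))
  · exact .imp (primrecPred_toNat_lt hN hAB) (.imp (.or (primrecPred_isBoethius hA hB)
      (.and (primrecPred_mem ht (primrec_arrow dA dB)) (mA.not.or mB))) mAB)

theorem primrecPred_accessible (hN : Primrec N) (ht : Primrec t) (hs : Primrec s) :
    PrimrecPred fun a => Accessible (N a) (t a) (s a) := by
  refine .forall_lt_of hN ?_
  have hA : Primrec fun x : α × ℕ => ofNat x.2 := primrec_ofNat.comp .snd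
  have ht' := ht.comp (Primrec.fst (α := α) (β := ℕ))
  have ms := primrecPred_mem (hs.comp .fst) hA
  exact .and (.imp (primrecPred_mem ht' (primrec_box hA)) ms)
    (.imp (primrecPred_toNat_lt (hN.comp .fst) (primrec_dia hA))
      (.imp ms (primrecPred_mem ht' (primrec_dia hA))))

theorem primrec_two_pow (hN : Primrec N) : Primrec fun a => 2 ^ N a :=
  Primrec.nat_pow.comp (.const 2) hN

theorem primrecPred_saturated (hN : Primrec N) (hM : Primrec M) (ht : Primrec t)
    (hA : Primrec A) : PrimrecPred fun a => Saturated (N a) (M a) (t a) (A a) := by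
  have hM' : PrimrecPred fun x : α × ℕ => (M x.1).testBit x.2 = true :=
    Primrec.nat_testBit.comp (hM.comp .fst) .snd
  have hacc : PrimrecPred fun x : α × ℕ => Accessible (N x.1) (t x.1) x.2 :=
    primrecPred_accessible (hN.comp .fst) (ht.comp .fst) .snd
  have hmem : PrimrecPred fun x : α × ℕ => Mem x.2 (A x.1) :=
    primrecPred_mem .snd (hA.comp .fst)
  refine .and (.imp (primrecPred_toNat_lt hN (primrec_box hA))
    (.imp (primrecPred_mem ht (primrec_box hA)).not ?_))
      (.imp (primrecPred_mem ht (primrec_dia hA)) ?_)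
  · exact .exists_lt_of (primrec_two_pow hN) (hM'.and (hacc.and hmem.not))
  · exact .exists_lt_of (primrec_two_pow hN) (hM'.and (hacc.and hmem))

theorem primrecPred_isModel (hN : Primrec N) (hM : Primrec M) :
    PrimrecPred fun a => IsModel (N a) (M a) := by
  refine .forall_lt_of (primrec_two_pow hN) (.imp (Primrec.nat_testBit.comp (hM.comp .fst) .snd)
    (.and ?_ ?_))
  · refine .forall_lt_of (hN.comp .fst) (.forall_lt_of (hN.comp (Primrec.fst.comp .fst)) ?_)
    exact primrecPred_local (hN.comp (Primrec.fst.comp (Primrec.fst.comp .fst)))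
      (Primrec.snd.comp (Primrec.fst.comp .fst)) (primrec_ofNat.comp (Primrec.snd.comp .fst))
      (primrec_ofNat.comp .snd)
  · refine .forall_lt_of (hN.comp .fst) ?_
    exact primrecPred_saturated (hN.comp (Primrec.fst.comp .fst))
      (hM.comp (Primrec.fst.comp .fst)) (Primrec.snd.comp .fst) (primrec_ofNat.comp .snd)

theorem primrecPred_isCountermodel (hN : Primrec N) (hM : Primrec M) (hA : Primrec A) :
    PrimrecPred fun a => IsCountermodel (N a) (M a) (A a) :=
  .and (primrecPred_isModel hN hM) (.exists_lt_of (primrec_two_pow hN)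
    (.and (Primrec.nat_testBit.comp (hM.comp .fst) .snd)
      (primrecPred_mem .snd (hA.comp .fst)).not))

end

/-- All quantifiers in the countermodel criterion are bounded by primitive recursive functions of
the code of the formula, the outermost by a double exponential. -/
theorem primrecPred_derivable : PrimrecPred Derivable := by
  have hN : Primrec fun A : Formula => toNat A + 1 := Primrec.succ.comp primrec_toNat
  refine PrimrecPred.of_eq (.not (.exists_lt_of (primrec_two_pow (primrec_two_pow hN)) ?_))
    fun A => (derivable_iff_not_exists_isCountermodel A).symm
  exact primrecPred_isCountermodel (hN.comp .fst) .snd .fst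

end MBCL

theorem mainTheorem4 : ComputablePred (fun A : MBCL.Formula => MBCL.Derivable A) :=
  MBCL.primrecPred_derivable.computablePred
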